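/- Let $\mathcal X$ be a finite set and let $\rho>0$. All logarithms are natural. A discrete memoryless channel $W$ with input and output alphabet $\mathcal X$ is given by transition probabilities $W(y|x)$, $x,y\in\mathcal X$; it is called $\varepsilon$-noise if $W(x|x)\ge 1-\varepsilon$ for all $x\in\mathcal X$. A blocklength-$n$ rate-$R$ feedback encoder with $R\ge 0$ consists of maps $f^{(i)}\colon\{1,\dots,M\}\times\mathcal X^{i-1}\to\mathcal X$, $i=1,\dots,n$, where $M=\lfloor e^{nR}\rfloor$; sending message $m$ induces the output law $Q(\mathbf y|m)=\prod_{i=1}^n W\bigl(y_i\big|f^{(i)}(m,y^{i-1})\bigr)$ on $\mathcal X^n$, where $y^{i-1}=(y_1,\dots,y_{i-1})$. An encoder without feedback is a map $f\colon\{1,\dots,M\}\to\mathcal X^n$, and its output law is $Q(\mathbf y|m)=\prod_{i=1}^n W(y_i|f(m)_i)$. Let $\mathcal L(\mathbf y)=\{m: Q(\mathbf y|m)>0\}$ be the list of all messages that can produce $\mathbf y$. The listsize capacity $C_{\mathrm{list}}(\rho,W)$ (respectively, the listsize capacity with feedback $C_{\mathrm{list,f}}(\rho,W)$) is the supremum of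 all rates $R\ge 0$ for which there is a sequence of blocklength-$n$ rate-$R$ encoders without feedback (respectively, with feedback), $n\ge1$, such that \[ \lim_{n\to\infty}\frac1M\sum_{m=1}^{M}\sum_{\mathbf y\in\mathcal X^n}Q(\mathbf y|m)\,|\mathcal L(\mathbf y)|^\rho=1,\qquad M=\lfloor e^{nR}\rfloor . \] Then \[ \lim_{\varepsilon\to0} C_{\mathrm{list,f}}(\rho,W)=\log|\mathcal X|, \] uniformly over all $\varepsilon$-noise channels $W$ with input and output alphabet $\mathcal X$ for which $C_{\mathrm{list}}(\rho,W)>0$. That is, for every $\delta>0$ there is an $\varepsilon_0>0$ such that for every $0<\varepsilon<\varepsilon_0$ and every $\varepsilon$-noise channel $W$ from $\mathcal X$ to $\mathcal X$ with $C_{\mathrm{list}}(\rho,W)>0$, \[ \log|\mathcal X|-\delta< C_{\mathrm{list,f}}(\rho,W)<\log|\mathcal X|+\delta . \] -/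

import Mathlib

open Filter Topology

/-- A discrete memoryless channel: a channel matrix `W(y|x)`, written `W x y`. -/
structure DMC (X Y : Type*) [Fintype Y] where
  /-- the transition law, `trans x y = W(y|x)` -/
  trans : X → Y → ℝ
  nonneg : ∀ x y, 0 ≤ trans x y
  sum_eq_one : ∀ x, ∑ y, trans x y = 1

instance {X Y : Type*} [Fintype Y] : CoeFun (DMC X Y) (fun _ => X → Y → ℝ) :=
  ⟨DMC.trans⟩

/-- The number `⌊e^{nR}⌋` of messages of a blocklength-`n` rate-`R` encoder. -/
noncomputable def numMessages (n : ℕ) (R : ℝ) : ℕ := ⌊Real.exp (n * R)⌋₊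

/-- A blocklength-`n` encoder for `M` messages without feedback. -/
def Encoder (X : Type*) (M n : ℕ) : Type _ := Fin M → Fin n → X

/-- A blocklength-`n` encoder for `M` messages with feedback: the input at (0-based) time `i`
depends on the message and on the `i` previous channel outputs. -/
def FeedbackEncoder (X Y : Type*) (M n : ℕ) : Type _ :=
  (i : Fin n) → Fin M → (Fin (i : ℕ) → Y) → X

/-- The law `∏ i, W(y_i | x_i(m))` of the output sequence induced by sending message `m`. -/
def DMC.outputLaw {X Y : Type*} [Fintype Y] (W : DMC X Y) {M n : ℕ}
    (f : Encoder X M n) (m : Fin M) (y : Fin n → Y) : ℝ :=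
  ∏ i, W (f m i) (y i)

/-- The law `∏ i, W(y_i | f_i(m, y^{i-1}))` of the output sequence induced by sending message `m`
with a feedback encoder. -/
def DMC.outputLawFeedback {X Y : Type*} [Fintype Y] (W : DMC X Y) {M n : ℕ}
    (f : FeedbackEncoder X Y M n) (m : Fin M) (y : Fin n → Y) : ℝ :=
  ∏ i, W (f i m (Fin.take (i : ℕ) i.isLt.le y)) (y i)

open Classical in
/-- The list of all messages that can produce the output `y`, when message `m` induces the output
law `Q m`. -/
noncomputable def messageList {Ω : Type*} {M : ℕ} (Q : Fin M → Ω → ℝ) (y : Ω) :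
    Finset (Fin M) :=
  Finset.univ.filter (fun m => 0 < Q m y)

/-- The `ρ`-th moment of the length of the list of all possible messages, for a uniformly
distributed message. -/
noncomputable def listMoment {Ω : Type*} [Fintype Ω] {M : ℕ} (ρ : ℝ)
    (Q : Fin M → Ω → ℝ) : ℝ :=
  (M : ℝ)⁻¹ * ∑ m, ∑ y, Q m y * ((messageList Q y).card : ℝ) ^ ρ

/-- Rates `R` for which some sequence of encoders has `ρ`-th list moment tending to one. -/
def DMC.ListAchievable {X Y : Type*} [Fintype Y] (ρ : ℝ) (W : DMC X Y) (R : ℝ) : Prop :=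
  ∃ f : (n : ℕ) → Encoder X (numMessages n R) n,
    Tendsto (fun n => listMoment ρ (W.outputLaw (f n))) atTop (𝓝 1)

/-- Rates `R` for which some sequence of feedback encoders has `ρ`-th list moment tending
to one. -/
def DMC.ListAchievableFeedback {X Y : Type*} [Fintype Y] (ρ : ℝ) (W : DMC X Y)
    (R : ℝ) : Prop :=
  ∃ f : (n : ℕ) → FeedbackEncoder X Y (numMessages n R) n,
    Tendsto (fun n => listMoment ρ (W.outputLawFeedback (f n))) atTop (𝓝 1)

/-- The listsize capacity (for the `ρ`-th moment), as a supremum in the extended reals. -/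
noncomputable def DMC.listCapacity {X Y : Type*} [Fintype Y] (ρ : ℝ) (W : DMC X Y) : EReal :=
  ⨆ R : {R : ℝ // 0 ≤ R ∧ W.ListAchievable ρ R}, ((R : ℝ) : EReal)

/-- The listsize capacity with feedback (for the `ρ`-th moment), as a supremum in the extended
reals. -/
noncomputable def DMC.listCapacityFeedback {X Y : Type*} [Fintype Y] (ρ : ℝ) (W : DMC X Y) :
    EReal :=
  ⨆ R : {R : ℝ // 0 ≤ R ∧ W.ListAchievableFeedback ρ R}, ((R : ℝ) : EReal)

/-- `ε`-noise channels whose input and output alphabets coincide. -/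
def DMC.IsNoise {X : Type*} [Fintype X] (ε : ℝ) (W : DMC X X) : Prop :=
  ∀ x, 1 - ε ≤ W x x

/-! The upper bound is counting: an output with a one-element list serves one message, so when `M`
far exceeds `|X|^n` almost every message meets a list of length at least 2 and the moment stays near
or above `2^ρ > 1` (`le_listMoment`). For the lower bound, `C_list > 0` forces a zero `W a b = 0`,
since otherwise every list is full. A code of distance more than `2k` is sent, then feedback tells
the sender whether at most `k` letters were corrupted; the sender repeats `b` if so and `a` if not,
`k` times. One received `b` is proof of decodability, because `a` never yields `b`, and the list is
a single message. Failure has probability at most `ε^k (2^n + 1)`. With `k` about `σN`, a small `ε`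
makes this beat the worst-case list factor `M^ρ`, while small `σ` costs little rate. The bounds see
`W` only through `ε`, hence the uniformity. -/

/-! ### Sums of causal products, and output laws -/

theorem sum_prod_take_succ {X : Type*} [Fintype X] {n : ℕ}
    (g : (i : Fin (n + 1)) → (Fin (i : ℕ) → X) → X → ℝ) :
    ∑ y : Fin (n + 1) → X, ∏ i, g i (Fin.take (i : ℕ) i.isLt.le y) (y i) =
      ∑ y : Fin n → X, (∏ i : Fin n, g i.castSucc (Fin.take (i : ℕ) i.isLt.le y) (y i)) *
        ∑ x, g (Fin.last n) y x := by
  rw [← (Fin.snocEquiv (fun _ : Fin (n + 1) => X)).sum_comp, Fintype.sum_prod_type,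
    Finset.sum_comm]
  refine Finset.sum_congr rfl fun y _ => ?_
  rw [Finset.mul_sum]
  refine Finset.sum_congr rfl fun x _ => ?_
  rw [Fin.prod_univ_castSucc]
  have key : ∀ (j : Fin n), Fin.snoc (α := fun _ => X) y x j.castSucc = y j := fun j => by simp
  congr 1
  · refine Finset.prod_congr rfl fun i _ => ?_
    exact congrArg₂ (g i.castSucc) (funext fun j => key ⟨j, j.isLt.trans i.isLt⟩) (key i)
  · exact congrArg₂ (g (Fin.last n)) (funext key) (by simp [Fin.snocEquiv])

/-- Summing a causal product over all sequences: if the `i`-th factor sums to at most `c i` given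
any past, then the whole sums to at most `∏ i, c i`. -/
theorem sum_prod_take_le {X : Type*} [Fintype X] {n : ℕ}
    (g : (i : Fin n) → (Fin (i : ℕ) → X) → X → ℝ) (c : Fin n → ℝ)
    (hg : ∀ i h x, 0 ≤ g i h x) (hc : ∀ i h, ∑ x, g i h x ≤ c i) (hc0 : ∀ i, 0 ≤ c i) :
    ∑ y : Fin n → X, ∏ i, g i (Fin.take (i : ℕ) i.isLt.le y) (y i) ≤ ∏ i, c i := by
  induction n with
  | zero => simp
  | succ n ih =>
    rw [sum_prod_take_succ, Fin.prod_univ_castSucc]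
    calc _ ≤ ∑ y : Fin n → X,
          (∏ i : Fin n, g i.castSucc (Fin.take (i : ℕ) i.isLt.le y) (y i)) * c (Fin.last n) := by
          refine Finset.sum_le_sum fun y _ => ?_
          exact mul_le_mul_of_nonneg_left (hc (Fin.last n) y)
            (Finset.prod_nonneg fun i _ => hg _ _ _)
      _ ≤ _ := by
          rw [← Finset.sum_mul]
          exact mul_le_mul_of_nonneg_right
            (ih (fun i => g i.castSucc) (fun i => c i.castSucc) (fun i => hg i.castSucc)
              (fun i => hc i.castSucc) (fun i => hc0 i.castSucc)) (hc0 _)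

theorem sum_prod_take_eq_one {X : Type*} [Fintype X] {n : ℕ}
    (g : (i : Fin n) → (Fin (i : ℕ) → X) → X → ℝ) (hc : ∀ i h, ∑ x, g i h x = 1) :
    ∑ y : Fin n → X, ∏ i, g i (Fin.take (i : ℕ) i.isLt.le y) (y i) = 1 := by
  induction n with
  | zero => simp
  | succ n ih =>
    rw [sum_prod_take_succ]
    have h1 : ∀ y : Fin n → X, ∑ x, g (Fin.last n) y x = 1 := fun y => hc (Fin.last n) y
    simp only [h1, mul_one]
    exact ih (fun i => g i.castSucc) (fun i => hc i.castSucc)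

namespace DMC

variable {X : Type*} [Fintype X]

theorem outputLaw_nonneg (W : DMC X X) {M n : ℕ} (f : Encoder X M n) (m y) :
    0 ≤ W.outputLaw f m y := Finset.prod_nonneg fun _ _ => W.nonneg _ _

theorem sum_outputLaw (W : DMC X X) {M n : ℕ} (f : Encoder X M n) (m) :
    ∑ y, W.outputLaw f m y = 1 :=
  sum_prod_take_eq_one (fun i _ x => W (f m i) x) fun _ _ => W.sum_eq_one _

theorem outputLawFeedback_nonneg (W : DMC X X) {M n : ℕ} (f : FeedbackEncoder X X M n) (m y) :
    0 ≤ W.outputLawFeedback f m y := Finset.prod_nonneg fun _ _ => W.nonneg _ _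

theorem sum_outputLawFeedback (W : DMC X X) {M n : ℕ} (f : FeedbackEncoder X X M n) (m) :
    ∑ y, W.outputLawFeedback f m y = 1 :=
  sum_prod_take_eq_one (fun i h x => W (f i m h) x) fun _ _ => W.sum_eq_one _

theorem IsNoise.sum_ne_le [DecidableEq X] {ε : ℝ} {W : DMC X X} (h : W.IsNoise ε) (a : X) :
    ∑ x, (if x = a then 0 else W a x) ≤ ε := by
  have h1 : ∑ x, W a x = ∑ x, (if x = a then W a x else 0) + ∑ x, (if x = a then 0 else W a x) := by
    rw [← Finset.sum_add_distrib]
    exact Finset.sum_congr rfl fun x _ => by split_ifs <;> simp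
  rw [W.sum_eq_one] at h1
  have h2 := h a
  simp only [Finset.sum_ite_eq', Finset.mem_univ, if_true] at h1
  linarith

end DMC

/-! ### General bounds on the list moment -/

section ListMoment

variable {Ω : Type*} {M : ℕ} {ρ : ℝ} {Q : Fin M → Ω → ℝ}

theorem mem_messageList {m : Fin M} {y : Ω} : m ∈ messageList Q y ↔ 0 < Q m y := by
  simp [messageList]

variable [Fintype Ω]

theorem one_le_listMoment (hρ : 0 < ρ) (hM : 0 < M) (hQ : ∀ m y, 0 ≤ Q m y)
    (hQ1 : ∀ m, ∑ y, Q m y = 1) : 1 ≤ listMoment ρ Q := by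
  have hM' : (0 : ℝ) < M := by exact_mod_cast hM
  have h : ∀ m, 1 ≤ ∑ y, Q m y * ((messageList Q y).card : ℝ) ^ ρ := fun m => by
    rw [← hQ1 m]
    refine Finset.sum_le_sum fun y _ => ?_
    rcases (hQ m y).eq_or_lt with h0 | h0
    · simp [← h0]
    · have : 1 ≤ (messageList Q y).card := Finset.card_pos.2 ⟨m, mem_messageList.2 h0⟩
      exact le_mul_of_one_le_right h0.le (Real.one_le_rpow (by exact_mod_cast this) hρ.le)
  have h2 : (M : ℝ) ≤ ∑ m, ∑ y, Q m y * ((messageList Q y).card : ℝ) ^ ρ := by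
    simpa using Finset.sum_le_sum fun m (_ : m ∈ Finset.univ) => h m
  rw [listMoment, inv_mul_eq_div]
  exact (one_le_div hM').2 h2

theorem listMoment_le {B : ℝ} (hB : 0 ≤ B)
    (h : ∀ m, ∑ y, Q m y * ((messageList Q y).card : ℝ) ^ ρ ≤ B) : listMoment ρ Q ≤ B := by
  rcases Nat.eq_zero_or_pos M with rfl | hM
  · simpa [listMoment] using hB
  have hM' : (0 : ℝ) < M := by exact_mod_cast hM
  rw [listMoment, inv_mul_eq_div, div_le_iff₀ hM']
  simpa [mul_comm] using Finset.sum_le_sum fun m (_ : m ∈ Finset.univ) => h m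

/-- Few output sequences force long lists. -/
theorem le_listMoment (hρ : 0 < ρ) (hM : 0 < M) (hQ : ∀ m y, 0 ≤ Q m y)
    (hQ1 : ∀ m, ∑ y, Q m y = 1) :
    2 ^ ρ - (2 ^ ρ - 1) * (Fintype.card Ω / M) ≤ listMoment ρ Q := by
  have hM' : (0 : ℝ) < M := by exact_mod_cast hM
  have h2ρ : (1 : ℝ) ≤ 2 ^ ρ := Real.one_le_rpow (by norm_num) hρ.le
  have hpt : ∀ m y, Q m y * 2 ^ ρ -
      (2 ^ ρ - 1) * (if (messageList Q y).card ≤ 1 then Q m y else 0) ≤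
        Q m y * ((messageList Q y).card : ℝ) ^ ρ := by
    intro m y
    rcases (hQ m y).eq_or_lt with h0 | h0
    · simp [← h0]
    · have : 1 ≤ (messageList Q y).card := Finset.card_pos.2 ⟨m, mem_messageList.2 h0⟩
      split_ifs with h
      · have : (messageList Q y).card = 1 := le_antisymm h this
        rw [this]; simp; linarith
      · have h3 : (2 : ℝ) ^ ρ ≤ ((messageList Q y).card : ℝ) ^ ρ :=
          Real.rpow_le_rpow (by norm_num) (by exact_mod_cast not_le.1 h) hρ.le
        have := mul_le_mul_of_nonneg_left h3 h0.le
        linarith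
  -- A list of length at most 1 leaves at most one nonzero term, itself a probability; summed over
  -- `y`, short lists carry mass at most `|Ω|`.
  have hone : ∀ y, ∑ m, (if (messageList Q y).card ≤ 1 then Q m y else 0) ≤ 1 := by
    intro y
    split_ifs with h
    · rcases (messageList Q y).eq_empty_or_nonempty with he | ⟨m, hm⟩
      · refine le_trans (Finset.sum_nonpos fun m _ => ?_) zero_le_one
        by_contra hc
        have := mem_messageList.2 (not_le.1 hc)
        simp [he] at this
      · rw [Finset.sum_eq_single m]
        · rw [← hQ1 m]
          exact Finset.single_le_sum (f := Q m) (fun y _ => hQ m y) (Finset.mem_univ y)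
        · intro m' _ hne
          by_contra hc
          have h0 := mem_messageList.2 ((hQ m' y).lt_of_ne' hc)
          exact hne (Finset.card_le_one.1 h _ h0 _ hm)
        · simp
    · simp
  have hsum : (M : ℝ) * 2 ^ ρ - (2 ^ ρ - 1) * Fintype.card Ω ≤
      ∑ m, ∑ y, Q m y * ((messageList Q y).card : ℝ) ^ ρ := by
    refine le_trans ?_ (Finset.sum_le_sum fun m _ => Finset.sum_le_sum fun y _ => hpt m y)
    simp only [Finset.sum_sub_distrib, ← Finset.sum_mul, ← Finset.mul_sum, hQ1]
    have : ∑ m, ∑ y, (if (messageList Q y).card ≤ 1 then Q m y else 0) ≤ Fintype.card Ω := by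
      rw [Finset.sum_comm]
      simpa using Finset.sum_le_sum fun y (_ : y ∈ Finset.univ) => hone y
    have := mul_le_mul_of_nonneg_left this (sub_nonneg.2 h2ρ)
    simp only [Finset.sum_const, Finset.card_univ, Fintype.card_fin, nsmul_eq_mul]
    linarith
  rw [listMoment, inv_mul_eq_div, le_div_iff₀ hM']
  refine le_trans (le_of_eq ?_) hsum
  field_simp

/-- If every message can produce every output, all lists are full. -/
theorem listMoment_of_pos (hM : 0 < M) (hQ : ∀ m y, 0 < Q m y)
    (hQ1 : ∀ m, ∑ y, Q m y = 1) : listMoment ρ Q = (M : ℝ) ^ ρ := by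
  have hM' : (M : ℝ) ≠ 0 := by exact_mod_cast hM.ne'
  have hL : ∀ y, messageList Q y = Finset.univ := fun y => by
    ext m; simp [mem_messageList, hQ]
  simp [listMoment, hL, ← Finset.sum_mul, hQ1, hM']

end ListMoment

/-! ### Size of the message set -/

section NumMessages

theorem numMessages_le (n : ℕ) (R : ℝ) : (numMessages n R : ℝ) ≤ Real.exp (n * R) :=
  Nat.floor_le (Real.exp_pos _).le

theorem numMessages_pos (n : ℕ) {R : ℝ} (hR : 0 ≤ R) : 0 < numMessages n R :=
  Nat.floor_pos.2 (Real.one_le_exp (by positivity))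

theorem exp_le_two_mul_numMessages (n : ℕ) {R : ℝ} (hR : 0 ≤ R) :
    Real.exp (n * R) ≤ 2 * numMessages n R := by
  have h1 : (1 : ℝ) ≤ numMessages n R := by exact_mod_cast numMessages_pos n hR
  have h2 : Real.exp (n * R) < numMessages n R + 1 := Nat.lt_floor_add_one _
  linarith

end NumMessages

/-! ### The converse, and the zero of the channel matrix -/

namespace DMC

variable {X : Type*} [Fintype X] {ρ : ℝ}

theorem ListAchievableFeedback.le_log_card (hρ : 0 < ρ) {W : DMC X X} {R : ℝ} (hR : 0 ≤ R)
    (hX : 0 < Fintype.card X) (h : W.ListAchievableFeedback ρ R) :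
    R ≤ Real.log (Fintype.card X) := by
  obtain ⟨f, hf⟩ := h
  by_contra hlt
  rw [not_le] at hlt
  have hX' : (0 : ℝ) < Fintype.card X := by exact_mod_cast hX
  set r : ℝ := Fintype.card X * Real.exp (-R) with hr
  have hr1 : r < 1 := by
    have := (Real.log_lt_iff_lt_exp hX').1 hlt
    rw [hr, Real.exp_neg, ← div_eq_mul_inv]
    exact (div_lt_one (Real.exp_pos _)).2 this
  have hle : ∀ n : ℕ, (Fintype.card (Fin n → X) : ℝ) / numMessages n R ≤ 2 * r ^ n := by
    intro n
    have hM : (0 : ℝ) < numMessages n R := by exact_mod_cast numMessages_pos n hR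
    rw [div_le_iff₀ hM, hr, mul_pow, ← Real.exp_nat_mul]
    have h1 := exp_le_two_mul_numMessages n hR
    have h2 : Real.exp (n * -R) * Real.exp (n * R) = 1 := by
      rw [← Real.exp_add]; simp
    have h3 : (1 : ℝ) ≤ Real.exp (n * -R) * (2 * numMessages n R) :=
      h2 ▸ mul_le_mul_of_nonneg_left h1 (Real.exp_pos _).le
    have h4 := mul_le_mul_of_nonneg_left h3 (pow_nonneg hX'.le n)
    simp only [Fintype.card_pi, Finset.prod_const, Finset.card_univ, Fintype.card_fin,
      Nat.cast_pow]
    linarith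
  have h2ρ : (1 : ℝ) < 2 ^ ρ := Real.one_lt_rpow (by norm_num) hρ
  have hlim : Tendsto (fun n : ℕ => (2 : ℝ) ^ ρ - (2 ^ ρ - 1) * (2 * r ^ n)) atTop
      (𝓝 (2 ^ ρ - (2 ^ ρ - 1) * (2 * 0))) :=
    (((tendsto_pow_atTop_nhds_zero_of_lt_one (by positivity) hr1).const_mul 2).const_mul
      _).const_sub _
  have := le_of_tendsto_of_tendsto' hlim hf fun n =>
    le_trans (sub_le_sub_left (mul_le_mul_of_nonneg_left (hle n) (by linarith)) _)
      (le_listMoment hρ (numMessages_pos n hR) (W.outputLawFeedback_nonneg (f n))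
        (W.sum_outputLawFeedback (f n)))
  simp only [mul_zero, sub_zero] at this
  linarith

/-- Positive listsize capacity requires a zero in the channel matrix. -/
theorem exists_eq_zero_of_listCapacity_pos (hρ : 0 < ρ) {W : DMC X X}
    (h : 0 < W.listCapacity ρ) : ∃ a b, W a b = 0 := by
  obtain ⟨⟨R, hR, f, hf⟩, hR0⟩ := lt_iSup_iff.1 h
  replace hR0 : 0 < R := by exact_mod_cast hR0
  by_contra! hne
  have hpos : ∀ a b, 0 < W a b := fun a b => (W.nonneg a b).lt_of_ne' (hne a b)
  have hM : Tendsto (fun n => numMessages n R) atTop atTop :=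
    tendsto_nat_floor_atTop.comp (Real.tendsto_exp_atTop.comp
      (tendsto_natCast_atTop_atTop.atTop_mul_const hR0))
  have hinf : Tendsto (fun n => (numMessages n R : ℝ) ^ ρ) atTop atTop :=
    (tendsto_rpow_atTop hρ).comp (tendsto_natCast_atTop_atTop.comp hM)
  refine not_tendsto_nhds_of_tendsto_atTop hinf 1 (hf.congr fun n => ?_)
  exact listMoment_of_pos (numMessages_pos n hR)
    (fun m y => Finset.prod_pos fun i _ => hpos _ _) (W.sum_outputLaw (f n))

end DMC

/-! ### Codes of large Hamming distance -/

section Hamming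

variable {X : Type*} [DecidableEq X] {n : ℕ}

/-- In product form the weight can be summed letter by letter, which replaces estimates of Hamming
balls. -/
theorem pow_hammingDist (l : ℝ) (x y : Fin n → X) :
    l ^ hammingDist x y = ∏ i, (if x i = y i then 1 else l) := by
  rw [Finset.prod_ite]
  simp [hammingDist]

variable [Fintype X]

theorem sum_pow_hammingDist_le {l : ℝ} (hl : 0 ≤ l) (x : Fin n → X) :
    ∑ y, l ^ hammingDist x y ≤ (1 + Fintype.card X * l) ^ n := by
  have h := sum_prod_take_le (fun i _ b => if x i = b then (1 : ℝ) else l)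
    (fun _ => 1 + Fintype.card X * l) (fun i _ b => by split_ifs <;> simp [hl])
    (fun i _ => ?_) (fun _ => by positivity)
  · simp only [pow_hammingDist]
    simpa using h
  · calc _ ≤ ∑ b, ((if x i = b then (1 : ℝ) else 0) + l) :=
          Finset.sum_le_sum fun b _ => by split_ifs <;> simp [hl]
      _ = _ := by simp [Finset.sum_add_distrib]

/-- A Gilbert–Varshamov bound. -/
theorem exists_code {l : ℝ} (hl : 0 < l) (hl1 : l ≤ 1) (d M : ℕ)
    (hM : M * ((l⁻¹) ^ d * (1 + Fintype.card X * l) ^ n) ≤ (Fintype.card X : ℝ) ^ n) :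
    ∃ c : Fin M → Fin n → X, ∀ m m', m ≠ m' → d < hammingDist (c m) (c m') := by
  induction M with
  | zero => exact ⟨fun m => m.elim0, fun m => m.elim0⟩
  | succ M ih =>
    have hV : 0 < (l⁻¹) ^ d * (1 + Fintype.card X * l) ^ n := by positivity
    have hlt : M * ((l⁻¹) ^ d * (1 + Fintype.card X * l) ^ n) < (Fintype.card X : ℝ) ^ n := by
      push_cast at hM
      linarith
    obtain ⟨c, hc⟩ := ih hlt.le
    -- Otherwise the balls of radius `d` cover the space. Inside a ball the weight `l⁻ᵈ l^dist` is
    -- at least 1, so the total weight would reach `|X|^n`.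
    obtain ⟨u, hu⟩ : ∃ u, ∀ m, d < hammingDist (c m) u := by
      by_contra! hcov
      refine hlt.not_ge ?_
      calc (Fintype.card X : ℝ) ^ n = ∑ _u : Fin n → X, (1 : ℝ) := by simp
        _ ≤ ∑ u : Fin n → X, ∑ m, (l⁻¹) ^ d * l ^ hammingDist (c m) u := by
            refine Finset.sum_le_sum fun u _ => ?_
            obtain ⟨m, hm⟩ := hcov u
            refine le_trans ?_ (Finset.single_le_sum
              (f := fun m => (l⁻¹) ^ d * l ^ hammingDist (c m) u)
              (fun m _ => by positivity) (Finset.mem_univ m))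
            have h1 := pow_le_pow_of_le_one hl.le hl1 hm
            rw [inv_pow, inv_mul_eq_div]
            exact (one_le_div (by positivity)).2 h1
        _ ≤ _ := by
            rw [Finset.sum_comm]
            refine le_trans (Finset.sum_le_sum fun m _ => ?_) (le_of_eq (by
              rw [Finset.sum_const, Finset.card_univ, Fintype.card_fin, nsmul_eq_mul]))
            rw [← Finset.mul_sum]
            exact mul_le_mul_of_nonneg_left (sum_pow_hammingDist_le hl.le _) (by positivity)
    refine ⟨Fin.snoc (α := fun _ => Fin n → X) c u, fun m m' => ?_⟩
    refine Fin.lastCases ?_ (fun m => ?_) m <;> refine Fin.lastCases ?_ (fun m' => ?_) m'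
    · simp
    · intro _
      simpa [hammingDist_comm] using hu m'
    · intro _
      simpa using hu m
    · intro hne
      simpa using hc m m' fun h => hne (by rw [h])

end Hamming

/-! ### The confirmation scheme and its two failure events -/

section Confirmation

variable {X : Type*} [DecidableEq X] {M n k : ℕ}

/-- The feedback encoder that sends a codeword of length `n`, and then tells the receiver `k` times
whether at most `t` letters of it were corrupted: the letter `b` if so, the letter `a` if not. -/
def confirmationEncoder (c : Fin M → Fin n → X) (a b : X) (t k : ℕ) :
    FeedbackEncoder X X M (n + k) := fun i m h =>
  if hi : (i : ℕ) < n then c m ⟨i, hi⟩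
  else if hammingDist (c m) (fun j => h (Fin.castLE (not_lt.1 hi) j)) ≤ t then b else a

variable [Fintype X] (W : DMC X X) {c : Fin M → Fin n → X} {a b : X} {t : ℕ}

/-- A message with more than `t` corrupted letters would send only `a` in the confirmation, which
cannot become `b`. So all listed codewords lie within `t` of the output, and the distance leaves
room for one. -/
theorem card_messageList_confirmationEncoder_le (hab : W a b = 0)
    (hc : ∀ m m', m ≠ m' → 2 * t < hammingDist (c m) (c m')) {y : Fin (n + k) → X}
    (hy : ∃ i : Fin k, y (Fin.natAdd n i) = b) :
    (messageList (W.outputLawFeedback (confirmationEncoder c a b t k)) y).card ≤ 1 := by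
  obtain ⟨i, hi⟩ := hy
  have key : ∀ m, m ∈ messageList (W.outputLawFeedback (confirmationEncoder c a b t k)) y →
      hammingDist (c m) (fun j => y (Fin.castAdd k j)) ≤ t := by
    intro m hm
    rw [mem_messageList] at hm
    by_contra hd
    refine hm.ne' (Finset.prod_eq_zero (Finset.mem_univ (Fin.natAdd n i)) ?_)
    have : confirmationEncoder c a b t k (Fin.natAdd n i) m
        (Fin.take _ (Fin.natAdd n i).isLt.le y) = a := by
      rw [confirmationEncoder, dif_neg (by simp)]
      exact if_neg hd
    rw [this, hi, hab]
  rw [Finset.card_le_one]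
  intro m hm m' hm'
  by_contra hne
  have h1 := hc m m' hne
  have h2 := hammingDist_triangle_right (c m) (c m') (fun j => y (Fin.castAdd k j))
  have h3 := key m hm
  have h4 := key m' hm'
  omega

variable {W}

/-- Exponential Markov inequality: weighting each corrupted letter by `ε⁻¹` gives mean at most `1 +
ε * ε⁻¹ = 2` per letter. -/
theorem sum_outputLawFeedback_of_far_le {ε : ℝ} (hε : 0 < ε) (hε1 : ε ≤ 1) (hW : W.IsNoise ε)
    (m : Fin M) :
    ∑ y, (if hammingDist (c m) (fun j => y (Fin.castAdd k j)) ≤ t then 0 else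
      W.outputLawFeedback (confirmationEncoder c a b t k) m y) ≤ ε ^ t * 2 ^ n := by
  set f := confirmationEncoder c a b t k
  let w : (i : Fin (n + k)) → X → ℝ := fun i x =>
    if hi : (i : ℕ) < n then (if c m ⟨i, hi⟩ = x then 1 else ε⁻¹) else 1
  have hw0 : ∀ i x, 0 ≤ w i x := fun i x => by
    dsimp only [w]; split_ifs <;> positivity
  have h := sum_prod_take_le (fun i h x => W (f i m h) x * w i x)
    (fun i => if (i : ℕ) < n then 2 else 1)
    (fun i h x => mul_nonneg (W.nonneg _ _) (hw0 i x)) (fun i h => ?_)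
    (fun i => by split_ifs <;> norm_num)
  · have hprod : ∏ i : Fin (n + k), (if (i : ℕ) < n then (2 : ℝ) else 1) = 2 ^ n := by
      rw [Fin.prod_univ_add]; simp
    rw [hprod] at h
    refine le_trans ?_ (mul_le_mul_of_nonneg_left h (pow_nonneg hε.le t))
    rw [Finset.mul_sum]
    refine Finset.sum_le_sum fun y _ => ?_
    rw [Finset.prod_mul_distrib]
    have hwp : ∏ i, w i (y i) = (ε⁻¹) ^ hammingDist (c m) (fun j => y (Fin.castAdd k j)) := by
      rw [Fin.prod_univ_add, pow_hammingDist]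
      simp [w]
    have hQ := W.outputLawFeedback_nonneg f m y
    change _ ≤ _ * (W.outputLawFeedback f m y * _)
    rw [hwp]
    split_ifs with hd
    · positivity
    · have h1 : (ε⁻¹) ^ t ≤ (ε⁻¹) ^ hammingDist (c m) (fun j => y (Fin.castAdd k j)) :=
        pow_le_pow_right₀ ((one_le_inv₀ hε).2 hε1) (not_le.1 hd).le
      have h2 : ε ^ t * (ε⁻¹) ^ t = 1 := by rw [← mul_pow, mul_inv_cancel₀ hε.ne', one_pow]
      have h3 := mul_le_mul_of_nonneg_left h1 (pow_nonneg hε.le t)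
      rw [h2] at h3
      have h4 := mul_le_mul_of_nonneg_left h3 hQ
      linarith
  · by_cases hi : (i : ℕ) < n
    · have hf : f i m h = c m ⟨i, hi⟩ := by simp only [f, confirmationEncoder, dif_pos hi]
      simp only [hf, w, dif_pos hi, if_pos hi]
      calc _ ≤ ∑ x, (W (c m ⟨i, hi⟩) x +
            (if x = c m ⟨i, hi⟩ then 0 else W (c m ⟨i, hi⟩) x) * ε⁻¹) := by
            refine Finset.sum_le_sum fun x _ => ?_
            have := W.nonneg (c m ⟨i, hi⟩) x
            by_cases hx : c m ⟨i, hi⟩ = x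
            · simp [hx]
            · simp [hx, Ne.symm hx, this]
        _ ≤ 1 + ε * ε⁻¹ := by
            rw [Finset.sum_add_distrib, W.sum_eq_one, ← Finset.sum_mul]
            gcongr
            exact hW.sum_ne_le _
        _ = 2 := by rw [mul_inv_cancel₀ hε.ne']; norm_num
    · simp [w, hi, W.sum_eq_one]

/-- Here `b` is sent `k` times and each copy is lost with probability at most `ε`. -/
theorem sum_outputLawFeedback_of_near_le {ε : ℝ} (hε : 0 < ε) (hW : W.IsNoise ε) (m : Fin M) :
    ∑ y, (if hammingDist (c m) (fun j => y (Fin.castAdd k j)) ≤ t ∧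
        ¬ ∃ i : Fin k, y (Fin.natAdd n i) = b then
      W.outputLawFeedback (confirmationEncoder c a b t k) m y else 0) ≤ ε ^ k := by
  set f := confirmationEncoder c a b t k with hf
  -- The indicator of the event is spread over the confirmation letters, each of which rereads the
  -- past; this makes it a causal product.
  let w : (i : Fin (n + k)) → (Fin (i : ℕ) → X) → X → ℝ := fun i h x =>
    if hi : (i : ℕ) < n then 1 else
      if hammingDist (c m) (fun j => h (Fin.castLE (not_lt.1 hi) j)) ≤ t ∧ x ≠ b then 1 else 0
  have hw0 : ∀ i h x, 0 ≤ w i h x := fun i h x => by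
    dsimp only [w]; split_ifs <;> norm_num
  have h := sum_prod_take_le (fun i h x => W (f i m h) x * w i h x)
    (fun i => if (i : ℕ) < n then 1 else ε)
    (fun i h x => mul_nonneg (W.nonneg _ _) (hw0 i h x)) (fun i h => ?_)
    (fun i => by split_ifs <;> positivity)
  · have hprod : ∏ i : Fin (n + k), (if (i : ℕ) < n then (1 : ℝ) else ε) = ε ^ k := by
      rw [Fin.prod_univ_add]; simp
    rw [hprod] at h
    refine le_trans (Finset.sum_le_sum fun y _ => ?_) h
    split_ifs with hd
    · refine le_of_eq (Finset.prod_congr rfl fun i _ => ?_)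
      have : w i (Fin.take i i.isLt.le y) (y i) = 1 := by
        dsimp only [w]
        split_ifs with hi hdi
        · rfl
        · rfl
        · refine absurd ⟨hd.1, fun hb => hd.2 ⟨⟨i - n, by omega⟩, ?_⟩⟩ hdi
          rw [← hb]
          congr 1
          ext
          simp; omega
      rw [this, mul_one]
    · exact Finset.prod_nonneg fun i _ => mul_nonneg (W.nonneg _ _) (hw0 _ _ _)
  · by_cases hi : (i : ℕ) < n
    · simp [w, hi, W.sum_eq_one]
    · simp only [w, dif_neg hi, if_neg hi]
      by_cases hd : hammingDist (c m) (fun j => h (Fin.castLE (not_lt.1 hi) j)) ≤ t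
      · have hfb : f i m h = b := by simp only [hf, confirmationEncoder, dif_neg hi, if_pos hd]
        simp only [hfb, hd, true_and]
        refine le_trans (le_of_eq (Finset.sum_congr rfl fun x _ => ?_)) (hW.sum_ne_le b)
        by_cases hx : x = b <;> simp [hx]
      · simp [hd, hε.le]

/-- Off the two failure events the list has length at most 1; on them the trivial bound `M` is used.
-/
theorem listMoment_confirmationEncoder_le {ε ρ : ℝ} (hρ : 0 < ρ) (hε : 0 < ε) (hε1 : ε ≤ 1)
    (hW : W.IsNoise ε) (hab : W a b = 0)
    (hc : ∀ m m', m ≠ m' → 2 * t < hammingDist (c m) (c m')) :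
    listMoment ρ (W.outputLawFeedback (confirmationEncoder c a b t k)) ≤
      1 + (M : ℝ) ^ ρ * (ε ^ t * 2 ^ n + ε ^ k) := by
  refine listMoment_le (by positivity) fun m => ?_
  set Q := W.outputLawFeedback (confirmationEncoder c a b t k)
  have hQ : ∀ y, 0 ≤ Q m y := W.outputLawFeedback_nonneg _ m
  calc _ ≤ ∑ y, (Q m y + (M : ℝ) ^ ρ *
        ((if hammingDist (c m) (fun j => y (Fin.castAdd k j)) ≤ t then 0 else Q m y) +
          (if hammingDist (c m) (fun j => y (Fin.castAdd k j)) ≤ t ∧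
            ¬ ∃ i : Fin k, y (Fin.natAdd n i) = b then Q m y else 0))) := by
        refine Finset.sum_le_sum fun y _ => ?_
        have hMρ : (0 : ℝ) ≤ (M : ℝ) ^ ρ := by positivity
        have h0 := hQ y
        have hprod := mul_nonneg hMρ h0
        by_cases hb : ∃ i : Fin k, y (Fin.natAdd n i) = b
        · have h1 := card_messageList_confirmationEncoder_le W hab hc hb
          have h2 : ((messageList Q y).card : ℝ) ^ ρ ≤ 1 :=
            Real.rpow_le_one (by positivity) (by exact_mod_cast h1) hρ.le
          have h3 := mul_le_mul_of_nonneg_left h2 h0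
          split_ifs <;> nlinarith
        · have h1 : (messageList Q y).card ≤ M := by
            simpa using Finset.card_le_univ (messageList Q y)
          have h2 : ((messageList Q y).card : ℝ) ^ ρ ≤ (M : ℝ) ^ ρ :=
            Real.rpow_le_rpow (by positivity) (by exact_mod_cast h1) hρ.le
          have h3 := mul_le_mul_of_nonneg_left h2 h0
          by_cases hd : hammingDist (c m) (fun j => y (Fin.castAdd k j)) ≤ t <;>
            simp only [hd, hb, not_false_eq_true, and_self, false_and, if_true, if_false] <;>
            nlinarith
    _ ≤ _ := by
        rw [Finset.sum_add_distrib, W.sum_outputLawFeedback, ← Finset.mul_sum,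
          Finset.sum_add_distrib]
        gcongr
        · exact sum_outputLawFeedback_of_far_le hε hε1 hW m
        · exact sum_outputLawFeedback_of_near_le hε hW m

end Confirmation

/-! ### Achievability with feedback -/

namespace DMC

variable {X : Type*} [Fintype X] {ρ : ℝ}

theorem listAchievableFeedback_zero [Nonempty X] (W : DMC X X) :
    W.ListAchievableFeedback ρ 0 := by
  refine ⟨fun n i m h => Classical.arbitrary X, tendsto_const_nhds.congr fun n => ?_⟩
  have hM : numMessages n 0 = 1 := by simp [numMessages]
  set f : FeedbackEncoder X X (numMessages n 0) n := fun i m h => Classical.arbitrary X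
  have hsub : ∀ m y, W.outputLawFeedback f m y *
      ((messageList (W.outputLawFeedback f) y).card : ℝ) ^ ρ = W.outputLawFeedback f m y := by
    intro m y
    rcases (W.outputLawFeedback_nonneg f m y).eq_or_lt with h0 | h0
    · simp [← h0]
    · have h1 : 1 ≤ (messageList (W.outputLawFeedback f) y).card :=
        Finset.card_pos.2 ⟨m, mem_messageList.2 h0⟩
      have h2 : (messageList (W.outputLawFeedback f) y).card ≤ 1 := by
        simpa [hM] using Finset.card_le_univ (messageList (W.outputLawFeedback f) y)
      rw [le_antisymm h2 h1]
      simp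
  change 1 = listMoment ρ (W.outputLawFeedback f)
  simp [listMoment, hsub, W.sum_outputLawFeedback, hM]

/-- With feedback, all rates `R` below `log |X|` are achievable when the noise is small enough for
a list of `e^{nR}` messages to be outweighed by the probability of `σ n` errors. -/
theorem listAchievableFeedback_of_isNoise (hρ : 0 < ρ) {W : DMC X X} {ε R l σ : ℝ}
    (hε : 0 < ε) (hε1 : ε ≤ 1) (hW : W.IsNoise ε) {a b : X} (hab : W a b = 0) (hR : 0 ≤ R)
    (hl : 0 < l) (hl1 : l ≤ 1) (hσ : 0 < σ) (hσ1 : σ ≤ 1)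
    (hcode : R + σ * (2 * Real.log l⁻¹ + Real.log (Fintype.card X)) + Fintype.card X * l ≤
      Real.log (Fintype.card X))
    (herr : Real.exp (ρ * R) * 2 * ε ^ σ < 1) :
    W.ListAchievableFeedback ρ R := by
  classical
  have hX : (1 : ℝ) ≤ Fintype.card X := by
    exact_mod_cast Fintype.card_pos_iff.2 ⟨a⟩
  -- The 2 accounts for the two failure events, and `ε⁻¹` for rounding `σ * N` down to `k`.
  have hbound : ∀ N : ℕ, ∃ f : FeedbackEncoder X X (numMessages N R) N,
      listMoment ρ (W.outputLawFeedback f) ≤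
        1 + (2 * ε⁻¹) * (Real.exp (ρ * R) * 2 * ε ^ σ) ^ N := by
    intro N
    have hsN : 0 ≤ σ * N := by positivity
    obtain ⟨k, hk⟩ : ∃ k, k = ⌊σ * N⌋₊ := ⟨_, rfl⟩
    have hk1 : (k : ℝ) ≤ σ * N := hk ▸ Nat.floor_le hsN
    have hk2 : σ * N < k + 1 := hk ▸ Nat.lt_floor_add_one _
    have hkN : k ≤ N := by
      have : (k : ℝ) ≤ N := hk1.trans (mul_le_of_le_one_left (by positivity) hσ1)
      exact_mod_cast this
    -- Only the inequalities on `k` are kept, so that `N` can be replaced by `n + k` although `k`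
    -- came from `N`.
    clear hk
    obtain ⟨n, rfl⟩ : ∃ n, N = n + k := ⟨N - k, by omega⟩
    have hlog : 0 ≤ Real.log l⁻¹ := Real.log_nonneg ((one_le_inv₀ hl).2 hl1)
    have hlogX : 0 ≤ Real.log (Fintype.card X) := Real.log_nonneg hX
    -- In `hcode`, `2 * log l⁻¹` pays for distance `2k`, and `log |X|` for the `k` letters spent on
    -- confirmation.
    obtain ⟨c, hc⟩ := exists_code (X := X) (n := n) hl hl1 (2 * k) (numMessages (n + k) R) (by
      have h1 : (l⁻¹) ^ (2 * k) = Real.exp ((2 * k : ℕ) * Real.log l⁻¹) := by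
        rw [Real.exp_nat_mul, Real.exp_log (by positivity)]
      have h2 : (Fintype.card X : ℝ) ^ n = Real.exp (n * Real.log (Fintype.card X)) := by
        rw [Real.exp_nat_mul, Real.exp_log (by positivity)]
      have h3 : (1 + Fintype.card X * l) ^ n ≤ Real.exp (n * (Fintype.card X * l)) := by
        rw [Real.exp_nat_mul]
        refine pow_le_pow_left₀ (by positivity) ?_ n
        rw [add_comm]
        exact Real.add_one_le_exp _
      calc _ ≤ Real.exp ((n + k : ℕ) * R) * (Real.exp ((2 * k : ℕ) * Real.log l⁻¹) *
            Real.exp (n * (Fintype.card X * l))) := by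
            rw [h1]
            gcongr
            exact numMessages_le _ _
        _ ≤ _ := by
            rw [h2, ← Real.exp_add, ← Real.exp_add]
            refine Real.exp_le_exp.2 ?_
            push_cast at hk1 ⊢
            have hcN := mul_le_mul_of_nonneg_left hcode (by positivity : (0 : ℝ) ≤ n + k)
            have h4 := mul_le_mul_of_nonneg_right hk1
              (by positivity : 0 ≤ 2 * Real.log l⁻¹ + Real.log (Fintype.card X))
            have h5 : 0 ≤ k * (Fintype.card X * l) := by positivity
            linarith)
    refine ⟨confirmationEncoder c a b k k,
      (listMoment_confirmationEncoder_le hρ hε hε1 hW hab hc).trans ?_⟩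
    have hM : ((numMessages (n + k) R : ℕ) : ℝ) ^ ρ ≤ Real.exp (ρ * R) ^ (n + k) := by
      rw [← Real.exp_nat_mul]
      refine (Real.rpow_le_rpow (by positivity) (numMessages_le _ _) hρ.le).trans (le_of_eq ?_)
      rw [← Real.exp_mul]
      congr 1
      ring
    have hεk : ε ^ k ≤ ε⁻¹ * (ε ^ σ) ^ (n + k) := by
      rw [← Real.rpow_natCast (ε ^ σ), ← Real.rpow_mul hε.le, ← Real.rpow_neg_one,
        ← Real.rpow_add hε, ← Real.rpow_natCast]
      exact Real.rpow_le_rpow_of_exponent_ge hε hε1 (by linarith)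
    have h2n : (1 : ℝ) ≤ 2 ^ (n + k) := one_le_pow₀ (by norm_num)
    have h2n' : (2 : ℝ) ^ n ≤ 2 ^ (n + k) := pow_le_pow_right₀ (by norm_num) (by omega)
    have h6 : ε ^ k * 2 ^ n + ε ^ k ≤ 2 * 2 ^ (n + k) * (ε⁻¹ * (ε ^ σ) ^ (n + k)) := by
      have := mul_le_mul_of_nonneg_left h2n (pow_pos hε k).le
      have := mul_le_mul_of_nonneg_left h2n' (pow_pos hε k).le
      have := mul_le_mul_of_nonneg_left hεk (by positivity : (0 : ℝ) ≤ 2 * 2 ^ (n + k))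
      linarith
    have h7 := mul_le_mul hM h6 (by positivity) (by positivity)
    rw [mul_pow, mul_pow]
    linarith
  choose f hf using hbound
  refine ⟨f, tendsto_of_tendsto_of_tendsto_of_le_of_le tendsto_const_nhds ?_ (fun N =>
    one_le_listMoment hρ (numMessages_pos N hR) (W.outputLawFeedback_nonneg (f N))
      (W.sum_outputLawFeedback (f N))) hf⟩
  have := ((tendsto_pow_atTop_nhds_zero_of_lt_one (by positivity) herr).const_mul
    (2 * ε⁻¹)).const_add 1
  simpa using this

end DMC

theorem proposition8 {X : Type*} [Fintype X] (ρ : ℝ) (hρ : 0 < ρ) (δ : ℝ) (hδ : 0 < δ) :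
    ∃ ε₀ : ℝ, 0 < ε₀ ∧ ∀ ε : ℝ, 0 < ε → ε < ε₀ →
      ∀ W : DMC X X, W.IsNoise ε → 0 < W.listCapacity ρ →
        ((Real.log (Fintype.card X) - δ : ℝ) : EReal) < W.listCapacityFeedback ρ ∧
        W.listCapacityFeedback ρ < ((Real.log (Fintype.card X) + δ : ℝ) : EReal) := by
  set q : ℝ := (Fintype.card X : ℝ) with hq
  have hq0 : 0 ≤ q := by positivity
  have hlogq : 0 ≤ Real.log q := Real.log_natCast_nonneg _
  -- Rates are nonnegative, so rate 0 stands in when the target is negative. The gap `δ / 2` is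
  -- split equally between `l` and `σ`.
  set R : ℝ := max 0 (Real.log q - δ / 2) with hRdef
  have hR : 0 ≤ R := le_max_left _ _
  obtain ⟨l, hl, hl1, hlδ⟩ : ∃ l : ℝ, 0 < l ∧ l ≤ 1 ∧ q * l ≤ δ / 4 := by
    refine ⟨min 1 (δ / 4 / (q + 1)), by positivity, min_le_left _ _, ?_⟩
    calc q * min 1 (δ / 4 / (q + 1)) ≤ (q + 1) * (δ / 4 / (q + 1)) := by
          gcongr
          · linarith
          · exact min_le_right _ _
      _ = δ / 4 := by field_simp
  have hlog : 0 ≤ Real.log l⁻¹ := Real.log_nonneg ((one_le_inv₀ hl).2 hl1)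
  set T : ℝ := 2 * Real.log l⁻¹ + Real.log q with hT
  have hT0 : 0 ≤ T := by positivity
  obtain ⟨σ, hσ, hσ1, hσδ⟩ : ∃ σ : ℝ, 0 < σ ∧ σ ≤ 1 ∧ σ * T ≤ δ / 4 := by
    refine ⟨min 1 (δ / 4 / (T + 1)), by positivity, min_le_left _ _, ?_⟩
    calc min 1 (δ / 4 / (T + 1)) * T ≤ (δ / 4 / (T + 1)) * (T + 1) := by
          gcongr
          · exact min_le_right _ _
          · linarith
      _ = δ / 4 := by field_simp
  set K : ℝ := Real.exp (ρ * R) * 2 with hK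
  have hK0 : 0 < K := by positivity
  -- This threshold is `K * ε ^ σ < 1` solved for `ε`; it is fixed before `W` is.
  refine ⟨min 1 ((K⁻¹) ^ σ⁻¹), by positivity, fun ε hε hεlt W hW hcap => ?_⟩
  have hε1 : ε ≤ 1 := (hεlt.trans_le (min_le_left _ _)).le
  have herr : Real.exp (ρ * R) * 2 * ε ^ σ < 1 := by
    have h1 : ε ^ σ < K⁻¹ := by
      have := Real.rpow_lt_rpow hε.le (hεlt.trans_le (min_le_right _ _)) hσ
      rwa [← Real.rpow_mul (by positivity), inv_mul_cancel₀ hσ.ne', Real.rpow_one] at this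
    rw [← hK]
    have h2 := mul_lt_mul_of_pos_left h1 hK0
    rwa [mul_inv_cancel₀ hK0.ne'] at h2
  obtain ⟨a, b, hab⟩ := DMC.exists_eq_zero_of_listCapacity_pos hρ hcap
  have : Nonempty X := ⟨a⟩
  have hach : W.ListAchievableFeedback ρ R := by
    rcases le_total (Real.log q - δ / 2) 0 with h | h
    · rw [hRdef, max_eq_left h]
      exact W.listAchievableFeedback_zero
    · refine DMC.listAchievableFeedback_of_isNoise hρ hε hε1 hW hab hR hl hl1 hσ hσ1 ?_ herr
      have : R = Real.log q - δ / 2 := max_eq_right h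
      linarith
  constructor
  · refine lt_of_lt_of_le ?_ (le_iSup (fun R : {R : ℝ // 0 ≤ R ∧ W.ListAchievableFeedback ρ R} =>
      ((R : ℝ) : EReal)) ⟨R, hR, hach⟩)
    refine EReal.coe_lt_coe_iff.2 (lt_of_lt_of_le ?_ (le_max_right _ _))
    linarith
  · refine lt_of_le_of_lt (iSup_le fun R' => ?_) (EReal.coe_lt_coe_iff.2 (lt_add_of_pos_right _ hδ))
    exact EReal.coe_le_coe_iff.2
      (R'.2.2.le_log_card hρ R'.2.1 Fintype.card_pos)
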